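/- Let $k$ be a commutative ring and let $A$ be a (left) gabi-algebra over $k$, i.e. a unital associative $k$-algebra equipped with $k$-algebra maps $\varepsilon\colon A\to k$ and $\delta\colon A\to A\otimes_k A^{\mathrm{op}}$, written $\delta(a)=a_+\otimes a_-$ (summation understood), such that for all $a\in A$ $$a_+\,\varepsilon(a_-)=a,\qquad a_+a_-=\varepsilon(a)1_A,\qquad a_{++}\otimes a_{-+}\otimes a_{--}a_{+-}=a_+\otimes a_-\otimes 1 .$$ Equip the category $A\text{-}\mathrm{Mod}$ of left $A$-modules with the left skew-closed structure lifted from $k\text{-}\mathrm{Mod}$: the internal hom is $[M,N]=\mathrm{Hom}_k(M,N)$ with action $(a\cdot f)(m)=a_+f(a_-m)$, the unit object is $k$ with $A$ acting through $\varepsilon$, and the structure maps are $i_M\colon[k,M]\to M$, $f\mapsto f(1)$; $j_M\colon k\to[M,M]$, $1\mapsto\mathrm{id}_M$; and $\Gamma^{M}_{N,P}\colon[N,P]\to[[M,N],[M,P]]$, $f\mapsto f\circ-$. Call this structure associative normal if for all $A$-modules $U,X,Y,Z$ the canonical map $$\hat\Gamma_{U,X,Y,Z}\colon\int^{V\in A\text{-}\mathrm{Mod}}\mathrm{Hom}_A(U,[V,Z])\times\mathrm{Hom}_A(X,[Y,V])\longrightarrow\mathrm{Hom}_A(U,[X,[Y,Z]]),\qquad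 (f,g)\mapsto[g,[Y,Z]]\circ\Gamma^{Y}_{V,Z}\circ f,$$ from the coend (taken in sets) is a bijection. Then the skew-closed structure on $A\text{-}\mathrm{Mod}$ is associative normal if and only if the canonical map $$\beta\colon A\otimes_k A\to A\otimes_k A,\qquad a\otimes b\mapsto a_+\otimes a_-b,$$ is invertible. -/

import Mathlib

open CategoryTheory Opposite
open scoped TensorProduct

universe v₁ u₁ u

/-- A (left) skew-closed structure on a category `C`: a unit object, an internal hom bifunctor
`[-,-] : Cᵒᵖ × C → C` (curried), and (di)natural transformations `i`, `j`, `Γ`, subject to the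
five axioms of a left skew-closed category.  The internal hom `[X, Y]` is
`(ihom.obj (op X)).obj Y`, the morphism `[X, g]` is `(ihom.obj (op X)).map g` and the morphism
`[f, Y]` is `(ihom.map f.op).app Y`. -/
structure SkewClosedStructure (C : Type u₁) [Category.{v₁} C] where
  /-- the unit object -/
  unit : C
  /-- the internal hom bifunctor -/
  ihom : Cᵒᵖ ⥤ C ⥤ C
  /-- `i : [1, -] ⟶ id` -/
  i : ihom.obj (op unit) ⟶ 𝟭 C
  /-- `j_X : 1 ⟶ [X, X]` -/
  j (X : C) : unit ⟶ (ihom.obj (op X)).obj X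
  /-- `Γ^X_{Y,Z} : [Y, Z] ⟶ [[X, Y], [X, Z]]` -/
  Γ (X Y Z : C) : (ihom.obj (op Y)).obj Z ⟶
    (ihom.obj (op ((ihom.obj (op X)).obj Y))).obj ((ihom.obj (op X)).obj Z)
  /-- dinaturality of `j` -/
  j_dinatural {X Y : C} (f : X ⟶ Y) :
    j X ≫ (ihom.obj (op X)).map f = j Y ≫ (ihom.map f.op).app Y
  /-- naturality of `Γ` in the first lower index -/
  Γ_natural_left (X : C) {Y Y' : C} (f : Y ⟶ Y') (Z : C) :
    (ihom.map f.op).app Z ≫ Γ X Y Z =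
      Γ X Y' Z ≫ (ihom.map ((ihom.obj (op X)).map f).op).app ((ihom.obj (op X)).obj Z)
  /-- naturality of `Γ` in the second lower index -/
  Γ_natural_right (X Y : C) {Z Z' : C} (g : Z ⟶ Z') :
    (ihom.obj (op Y)).map g ≫ Γ X Y Z' =
      Γ X Y Z ≫ (ihom.obj (op ((ihom.obj (op X)).obj Y))).map ((ihom.obj (op X)).map g)
  /-- dinaturality of `Γ` in the upper index -/
  Γ_dinatural {X X' : C} (h : X ⟶ X') (Y Z : C) :
    Γ X Y Z ≫ (ihom.map ((ihom.map h.op).app Y).op).app ((ihom.obj (op X)).obj Z) =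
      Γ X' Y Z ≫ (ihom.obj (op ((ihom.obj (op X')).obj Y))).map ((ihom.map h.op).app Z)
  /-- `i_1 ∘ j_1 = id` -/
  j_i : j unit ≫ i.app unit = 𝟙 unit
  /-- `i_{[X,Y]} ∘ [j_X, [X,Y]] ∘ Γ^X_{X,Y} = id` -/
  Γ_j_i (X Y : C) :
    Γ X X Y ≫ (ihom.map (j X).op).app ((ihom.obj (op X)).obj Y) ≫
      i.app ((ihom.obj (op X)).obj Y) = 𝟙 ((ihom.obj (op X)).obj Y)
  /-- `Γ^X_{Y,Y} ∘ j_Y = j_{[X,Y]}` -/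
  j_Γ (X Y : C) : j Y ≫ Γ X Y Y = j ((ihom.obj (op X)).obj Y)
  /-- `[[1,X], i_Y] ∘ Γ^1_{X,Y} = [i_X, Y]` -/
  Γ_i (X Y : C) :
    Γ unit X Y ≫ (ihom.obj (op ((ihom.obj (op unit)).obj X))).map (i.app Y) =
      (ihom.map (i.app X).op).app Y
  /-- the pentagon axiom
  `[Γ^U_{V,W}, 1] ∘ Γ^{[U,V]}_{[U,W],[U,X]} ∘ Γ^U_{W,X} = [1, Γ^U_{V,X}] ∘ Γ^V_{W,X}` -/
  Γ_Γ (U V W X : C) :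
    Γ U W X ≫
        Γ ((ihom.obj (op U)).obj V) ((ihom.obj (op U)).obj W) ((ihom.obj (op U)).obj X) ≫
        (ihom.map (Γ U V W).op).app ((ihom.obj (op ((ihom.obj (op U)).obj V))).obj
          ((ihom.obj (op U)).obj X)) =
      Γ V W X ≫ (ihom.obj (op ((ihom.obj (op V)).obj W))).map (Γ U V X)

namespace SkewClosedStructure

variable {C : Type u₁} [Category.{v₁} C] (S : SkewClosedStructure C)

/-- The bifunctor `(V', V) ↦ C(U, [V', Z]) × C(X, [Y, V])`, whose coend is the source of the
canonical morphism `Γ̂`. (The universe lift makes room for the coend over all objects of `C`.) -/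
@[simps]
def normalityIntegrand (U X Y Z : C) : Cᵒᵖ ⥤ C ⥤ Type (max u₁ v₁) where
  obj V' :=
    { obj V := ULift.{u₁} ((U ⟶ (S.ihom.obj V').obj Z) × (X ⟶ (S.ihom.obj (op Y)).obj V))
      map h := TypeCat.ofHom fun p => ⟨(p.down.1, p.down.2 ≫ (S.ihom.obj (op Y)).map h)⟩ }
  map h :=
    { app V := TypeCat.ofHom fun p => ⟨(p.down.1 ≫ (S.ihom.map h).app Z, p.down.2)⟩ }

/-- `Γ̂(f, g) = [g, [Y, Z]] ∘ Γ^Y_{V,Z} ∘ f`. -/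
def gammaHatComponent {U X Y Z V : C} (f : U ⟶ (S.ihom.obj (op V)).obj Z)
    (g : X ⟶ (S.ihom.obj (op Y)).obj V) :
    U ⟶ (S.ihom.obj (op X)).obj ((S.ihom.obj (op Y)).obj Z) :=
  f ≫ S.Γ Y V Z ≫ (S.ihom.map g.op).app ((S.ihom.obj (op Y)).obj Z)

/-- The canonical map `Γ̂ : ∫^V C(U, [V, Z]) × C(X, [Y, V]) ⟶ C(U, [X, [Y, Z]])`. -/
noncomputable def gammaHat (U X Y Z : C) :
    Limits.coend (S.normalityIntegrand U X Y Z) ⟶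
      ULift.{u₁} (U ⟶ (S.ihom.obj (op X)).obj ((S.ihom.obj (op Y)).obj Z)) :=
  Limits.coend.desc
    (fun _ => TypeCat.ofHom fun p => ⟨S.gammaHatComponent p.down.1 p.down.2⟩)
    (by
      intro V V' h
      ext p
      change (p.down.1 ≫ (S.ihom.map h.op).app Z) ≫ S.Γ Y V Z ≫ _ =
        p.down.1 ≫ S.Γ Y V' Z ≫ (S.ihom.map (p.down.2 ≫ (S.ihom.obj (op Y)).map h).op).app _
      rw [Category.assoc, reassoc_of% S.Γ_natural_left]
      simp
      rfl)

/-- Associative normality: every canonical map `Γ̂` is a bijection. -/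
def AssociativeNormal : Prop :=
  ∀ U X Y Z : C, Function.Bijective (S.gammaHat U X Y Z)

end SkewClosedStructure

section Gabi

variable (k A : Type u) [CommRing k] [Ring A] [Algebra k A]

/-- The identification `A ⊗ Aᵒᵖ → A ⊗ A` of `k`-modules. -/
def gabiUnop : A ⊗[k] Aᵐᵒᵖ →ₗ[k] A ⊗[k] A :=
  LinearMap.lTensor A (MulOpposite.opLinearEquiv k (M := A)).symm.toLinearMap

/-- The `k`-linear map `(x ⊗ y) ⊗ (z ⊗ w) ↦ x ⊗ (z ⊗ w y)`. -/
noncomputable def gabiContract :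
    (A ⊗[k] A) ⊗[k] (A ⊗[k] A) →ₗ[k] A ⊗[k] (A ⊗[k] A) :=
  LinearMap.lTensor A (LinearMap.lTensor A
      (LinearMap.mul' k A ∘ₗ (TensorProduct.comm k A A).toLinearMap)) ∘ₗ
    (TensorProduct.assoc k A A (A ⊗[k] A)).toLinearMap ∘ₗ
    (TensorProduct.tensorTensorTensorComm k A A A A).toLinearMap

/-- A (left) gabi-algebra structure on a `k`-algebra `A`: algebra maps `ε : A → k` and
`δ : A → A ⊗ Aᵒᵖ`, written `δ(a) = a₊ ⊗ a₋`, such that `a₊ ε(a₋) = a`, `a₊ a₋ = ε(a) 1` and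
`a₊₊ ⊗ a₋₊ ⊗ a₋₋ a₊₋ = a₊ ⊗ a₋ ⊗ 1`. -/
class GabiAlgebra where
  /-- the augmentation -/
  ε : A →ₐ[k] k
  /-- the comultiplication -/
  δ : A →ₐ[k] A ⊗[k] Aᵐᵒᵖ
  counit (a : A) :
    TensorProduct.rid k A (LinearMap.lTensor A ε.toLinearMap (gabiUnop k A (δ a))) = a
  antipode (a : A) : LinearMap.mul' k A (gabiUnop k A (δ a)) = algebraMap k A (ε a)
  coassoc (a : A) :
    gabiContract k A
        (TensorProduct.map (gabiUnop k A ∘ₗ δ.toLinearMap) (gabiUnop k A ∘ₗ δ.toLinearMap)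
          (gabiUnop k A (δ a))) =
      TensorProduct.assoc k A A A (gabiUnop k A (δ a) ⊗ₜ[k] (1 : A))

end Gabi

@[simp]
lemma gabiUnop_tmul (k A : Type u) [CommRing k] [Ring A] [Algebra k A] (x : A) (y : Aᵐᵒᵖ) :
    gabiUnop k A (x ⊗ₜ[k] y) = x ⊗ₜ[k] y.unop := rfl

@[simp]
lemma gabiContract_tmul (k A : Type u) [CommRing k] [Ring A] [Algebra k A] (x y z w : A) :
    gabiContract k A ((x ⊗ₜ[k] y) ⊗ₜ[k] (z ⊗ₜ[k] w)) = x ⊗ₜ[k] (z ⊗ₜ[k] (w * y)) := rfl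

namespace GabiAlgebra

section

variable (k : Type u) {A : Type u} [CommRing k] [Ring A] [Algebra k A]

/-- The underlying `k`-module of an `A`-module. -/
abbrev restrictedModule (M : ModuleCat.{u} A) : Module k M := Module.compHom M (algebraMap k A)

attribute [local instance] restrictedModule

lemma restricted_smul_def (M : ModuleCat.{u} A) (c : k) (m : M) :
    c • m = algebraMap k A c • m := rfl

instance restricted_isScalarTower (M : ModuleCat.{u} A) : IsScalarTower k A M :=
  IsScalarTower.of_algebraMap_smul fun _ _ => rfl

/-- The action of `A` on `Hom_k(M, N)` by post-composition. -/
noncomputable def bimoduleActionLeft (M N : ModuleCat.{u} A) :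
    A →ₐ[k] Module.End k (M →ₗ[k] N) where
  toFun a := LinearMap.llcomp k M N N (Algebra.lsmul k k N a)
  map_one' := by ext f m; simp
  map_mul' a b := by ext f m; simp
  map_zero' := by ext f m; simp
  map_add' a b := by ext f m; simp
  commutes' c := by ext f m; simp

/-- The action of `Aᵒᵖ` on `Hom_k(M, N)` by pre-composition. -/
noncomputable def bimoduleActionRight (M N : ModuleCat.{u} A) :
    Aᵐᵒᵖ →ₐ[k] Module.End k (M →ₗ[k] N) where
  toFun b := LinearMap.lcomp k N (Algebra.lsmul k k M b.unop)
  map_one' := by ext f m; simp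
  map_mul' a b := by ext f m; simp
  map_zero' := by ext f m; simp
  map_add' a b := by ext f m; simp
  commutes' c := by ext f m; simp

lemma bimoduleAction_commute (M N : ModuleCat.{u} A) (a : A) (b : Aᵐᵒᵖ) :
    Commute (bimoduleActionLeft k M N a) (bimoduleActionRight k M N b) := rfl

/-- The action of `A ⊗ Aᵒᵖ` on `Hom_k(M, N)`: `(a ⊗ b) f = (m ↦ a f(b m))`. -/
noncomputable def bimoduleAction (M N : ModuleCat.{u} A) :
    A ⊗[k] Aᵐᵒᵖ →ₐ[k] Module.End k (M →ₗ[k] N) :=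
  Algebra.TensorProduct.lift (bimoduleActionLeft k M N) (bimoduleActionRight k M N)
    (bimoduleAction_commute k M N)

lemma bimoduleAction_tmul (M N : ModuleCat.{u} A) (a : A) (b : Aᵐᵒᵖ) (f : M →ₗ[k] N) (m : M) :
    bimoduleAction k M N (a ⊗ₜ b) f m = a • f (b.unop • m) := by
  have h := Algebra.TensorProduct.lift_tmul (bimoduleActionLeft k M N) (bimoduleActionRight k M N)
    (bimoduleAction_commute k M N) a b
  exact congrArg (fun F : Module.End k (M →ₗ[k] N) => F f m) h

variable {k} in
/-- The `k`-linear map `x ⊗ (z ⊗ w) ↦ x f(z g(w m))`. -/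
noncomputable def evalTriple {M N P : ModuleCat.{u} A} (f : N →ₗ[k] P) (g : M →ₗ[k] N) (m : M) :
    A ⊗[k] (A ⊗[k] A) →ₗ[k] P :=
  TensorProduct.lift ((Algebra.lsmul k k P).toLinearMap.compl₂
    (f ∘ₗ TensorProduct.lift ((Algebra.lsmul k k N).toLinearMap.compl₂
      (g ∘ₗ (Algebra.lsmul k k M).toLinearMap.flip m))))

variable {k} in
@[simp] lemma evalTriple_tmul {M N P : ModuleCat.{u} A} (f : N →ₗ[k] P) (g : M →ₗ[k] N) (m : M)
    (x z w : A) : evalTriple f g m (x ⊗ₜ (z ⊗ₜ w)) = x • f (z • g (w • m)) := rfl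

/-- The `k`-linear maps `M → N` between (the underlying `k`-modules of) two `A`-modules. -/
def InternalHom (M N : ModuleCat.{u} A) : Type u := M →ₗ[k] N

instance (M N : ModuleCat.{u} A) : AddCommGroup (InternalHom k M N) :=
  inferInstanceAs (AddCommGroup (M →ₗ[k] N))

variable [GabiAlgebra k A]

/-- The lifted `A`-module structure on `Hom_k(M, N)`: `a` acts as `a₊ ⊗ a₋`, that is
`(a f)(m) = a₊ f(a₋ m)`. -/
noncomputable instance (M N : ModuleCat.{u} A) : Module A (InternalHom k M N) :=
  Module.compHom (M →ₗ[k] N)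
    ((bimoduleAction k M N).comp (GabiAlgebra.δ (k := k) (A := A))).toRingHom

/-- The internal hom object `[M, N]` of `A`-Mod. -/
noncomputable def homObj (M N : ModuleCat.{u} A) : ModuleCat.{u} A :=
  ModuleCat.of A (InternalHom k M N)

/-- Regard a `k`-linear map as an element of `[M, N]`. -/
def toHom {M N : ModuleCat.{u} A} (f : M →ₗ[k] N) : homObj k M N := f

/-- Regard an element of `[M, N]` as a `k`-linear map. -/
def ofHom {M N : ModuleCat.{u} A} (f : homObj k M N) : M →ₗ[k] N := f

variable {k}

@[simp] lemma ofHom_toHom {M N : ModuleCat.{u} A} (f : M →ₗ[k] N) : ofHom k (toHom k f) = f := rfl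

@[simp] lemma ofHom_add {M N : ModuleCat.{u} A} (f g : homObj k M N) :
    ofHom k (f + g) = ofHom k f + ofHom k g := rfl

lemma hom_ext {M N : ModuleCat.{u} A} {f g : homObj k M N}
    (h : ∀ m, ofHom k f m = ofHom k g m) : f = g :=
  LinearMap.ext (f := ofHom k f) (g := ofHom k g) h

lemma ofHom_smul {M N : ModuleCat.{u} A} (a : A) (f : homObj k M N) :
    ofHom k (a • f) = bimoduleAction k M N (GabiAlgebra.δ a) (ofHom k f) := rfl

@[simp] lemma ofHom_restricted_smul {M N : ModuleCat.{u} A} (c : k) (f : homObj k M N) :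
    ofHom k (c • f) = c • ofHom k f := by
  rw [restricted_smul_def, ofHom_smul, AlgHom.commutes, AlgHom.commutes]
  rfl

/-- `[f, g] : [M, N] → [M', N']`, `h ↦ g ∘ h ∘ f`, as an `A`-linear map. -/
noncomputable def homMapLinear {M M' N N' : ModuleCat.{u} A} (f : M' ⟶ M) (g : N ⟶ N') :
    homObj k M N →ₗ[A] homObj k M' N' where
  toFun h := toHom k ((g.hom.restrictScalars k) ∘ₗ ofHom k h ∘ₗ (f.hom.restrictScalars k))
  map_add' h h' := hom_ext fun m => by simp
  map_smul' a h := hom_ext fun m => by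
    simp only [ofHom_toHom, ofHom_smul, RingHom.id_apply, LinearMap.comp_apply,
      LinearMap.coe_restrictScalars]
    induction (GabiAlgebra.δ a : A ⊗[k] Aᵐᵒᵖ) using TensorProduct.induction_on with
    | zero => simp
    | tmul x y => simp [bimoduleAction_tmul]
    | add x y hx hy => simp_all

variable (k) in
/-- `[f, g] : [M, N] ⟶ [M', N']`, `h ↦ g ∘ h ∘ f`. -/
noncomputable def homMap {M M' N N' : ModuleCat.{u} A} (f : M' ⟶ M) (g : N ⟶ N') :
    homObj k M N ⟶ homObj k M' N' :=
  ModuleCat.ofHom (homMapLinear f g)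

@[simp] lemma ofHom_homMap {M M' N N' : ModuleCat.{u} A} (f : M' ⟶ M) (g : N ⟶ N')
    (h : homObj k M N) (m : M') :
    ofHom k ((homMap k f g).hom h) m = g.hom (ofHom k h (f.hom m)) := rfl

variable (k A) in
/-- The internal hom bifunctor of `A`-Mod, lifting that of `k`-Mod. -/
@[simps]
noncomputable def homFunctor : (ModuleCat.{u} A)ᵒᵖ ⥤ ModuleCat.{u} A ⥤ ModuleCat.{u} A where
  obj M :=
    { obj N := homObj k M.unop N
      map g := homMap k (𝟙 _) g
      map_id _ := rfl
      map_comp _ _ := rfl }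
  map f :=
    { app N := homMap k f.unop (𝟙 N)
      naturality _ _ _ := rfl }
  map_id _ := rfl
  map_comp _ _ := rfl

variable (k) in
/-- The base ring `k`, regarded as an `A`-module through the augmentation. -/
def UnitModule : Type u := k

instance : AddCommGroup (UnitModule k) := inferInstanceAs (AddCommGroup k)

noncomputable instance : Module A (UnitModule k) :=
  Module.compHom k (GabiAlgebra.ε (k := k) (A := A)).toRingHom

variable (k A) in
/-- The unit object: `k`, with `A` acting through the augmentation. -/
noncomputable def unitObj : ModuleCat.{u} A :=
  ModuleCat.of A (UnitModule k)

variable (k A) in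
/-- The element of the unit object given by a scalar. -/
def toUnit (c : k) : unitObj k A := c

/-- The scalar underlying an element of the unit object. -/
def ofUnit (x : unitObj k A) : k := x

@[simp] lemma ofUnit_toUnit (c : k) : ofUnit (toUnit k A c) = c := rfl

@[simp] lemma toUnit_ofUnit (x : unitObj k A) : toUnit k A (ofUnit x) = x := rfl

@[simp] lemma ofUnit_add (x y : unitObj k A) : ofUnit (x + y) = ofUnit x + ofUnit y := rfl

@[simp] lemma ofUnit_smul (a : A) (x : unitObj k A) :
    ofUnit (a • x) = GabiAlgebra.ε a * ofUnit x := rfl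

@[simp] lemma ofUnit_restricted_smul (c : k) (x : unitObj k A) :
    ofUnit (c • x) = c * ofUnit x := by
  rw [restricted_smul_def, ofUnit_smul, AlgHom.commutes]
  rfl

lemma unit_ext {x y : unitObj k A} (h : ofUnit x = ofUnit y) : x = y := h

lemma smul_toUnit_one (a : A) :
    a • toUnit k A 1 = (GabiAlgebra.ε a : k) • toUnit k A 1 :=
  unit_ext (by simp)

/-- `f ↦ f ∘ -` as a `k`-linear map. -/
noncomputable def postcomp {M N P : ModuleCat.{u} A} (f : N →ₗ[k] P) :
    homObj k M N →ₗ[k] homObj k M P where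
  toFun g := toHom k (f ∘ₗ ofHom k g)
  map_add' g g' := hom_ext fun m => by simp
  map_smul' c g := hom_ext fun m => by simp

@[simp] lemma ofHom_postcomp {M N P : ModuleCat.{u} A} (f : N →ₗ[k] P) (g : homObj k M N) (m : M) :
    ofHom k (postcomp f g) m = f (ofHom k g m) := rfl

lemma bimoduleAction_postcomp {M N P : ModuleCat.{u} A} (f : N →ₗ[k] P) (g : homObj k M N) (m : M)
    (t : A ⊗[k] Aᵐᵒᵖ) :
    ofHom k (bimoduleAction k (homObj k M N) (homObj k M P) t (postcomp f) g) m =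
      evalTriple f (ofHom k g) m (gabiContract k A
        (TensorProduct.map
          (gabiUnop k A ∘ₗ (GabiAlgebra.δ (k := k) (A := A)).toLinearMap)
          (gabiUnop k A ∘ₗ (GabiAlgebra.δ (k := k) (A := A)).toLinearMap)
          (gabiUnop k A t))) := by
  induction t using TensorProduct.induction_on with
  | zero => simp; rfl
  | add s t hs ht => simp [hs, ht]
  | tmul x y =>
    rw [bimoduleAction_tmul, ofHom_smul]
    simp only [gabiUnop_tmul, TensorProduct.map_tmul, LinearMap.comp_apply,
      AlgHom.toLinearMap_apply]
    induction (GabiAlgebra.δ x : A ⊗[k] Aᵐᵒᵖ) using TensorProduct.induction_on with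
    | zero => simp
    | add s t hs ht => simp [hs, ht, TensorProduct.add_tmul]
    | tmul p q =>
      rw [bimoduleAction_tmul, ofHom_postcomp, ofHom_smul]
      induction (GabiAlgebra.δ y.unop : A ⊗[k] Aᵐᵒᵖ) using TensorProduct.induction_on with
      | zero => simp
      | add s t hs ht => simp [hs, ht, TensorProduct.tmul_add]
      | tmul r s => simp [bimoduleAction_tmul, mul_smul]

/-- `f ↦ f ∘ -` as an `A`-linear map `[N, P] → [[M, N], [M, P]]`. -/
noncomputable def compLinear (M N P : ModuleCat.{u} A) :
    homObj k N P →ₗ[A] homObj k (homObj k M N) (homObj k M P) where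
  toFun f := toHom k (postcomp (ofHom k f))
  map_add' f f' := hom_ext fun g => hom_ext fun m => by simp
  map_smul' a f := hom_ext fun g => hom_ext fun m => by
    simp only [ofHom_toHom, RingHom.id_apply, ofHom_smul, ofHom_postcomp]
    rw [bimoduleAction_postcomp, GabiAlgebra.coassoc]
    induction (GabiAlgebra.δ a : A ⊗[k] Aᵐᵒᵖ) using TensorProduct.induction_on with
    | zero => simp
    | add s t hs ht => simp [hs, ht, TensorProduct.add_tmul]
    | tmul p q => simp [bimoduleAction_tmul]

variable (k) in
/-- `Γ^M_{N,P} : [N, P] ⟶ [[M, N], [M, P]]`, `f ↦ f ∘ -`. -/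
noncomputable def comp (M N P : ModuleCat.{u} A) :
    homObj k N P ⟶ homObj k (homObj k M N) (homObj k M P) :=
  ModuleCat.ofHom (compLinear M N P)

/-- `f ↦ f 1` as an `A`-linear map `[k, M] → M`. -/
noncomputable def evalOneLinear (M : ModuleCat.{u} A) : homObj k (unitObj k A) M →ₗ[A] M where
  toFun f := ofHom k f (toUnit k A 1)
  map_add' _ _ := rfl
  map_smul' a f := by
    have key : ∀ t : A ⊗[k] Aᵐᵒᵖ,
        bimoduleAction k (unitObj k A) M t (ofHom k f) (toUnit k A 1) =
          (TensorProduct.rid k A (LinearMap.lTensor A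
            (GabiAlgebra.ε (k := k) (A := A)).toLinearMap (gabiUnop k A t))) •
              ofHom k f (toUnit k A 1) := by
      intro t
      induction t using TensorProduct.induction_on with
      | zero => simp
      | add s t hs ht => simp [hs, ht, add_smul]
      | tmul p q =>
        rw [bimoduleAction_tmul, smul_toUnit_one, map_smul]
        simp only [gabiUnop_tmul, LinearMap.lTensor_tmul, TensorProduct.rid_tmul,
          AlgHom.toLinearMap_apply, smul_assoc]
        rw [smul_algebra_smul_comm]
    rw [ofHom_smul, key, GabiAlgebra.counit, RingHom.id_apply]

variable (k) in
/-- `i_M : [k, M] ⟶ M`, `f ↦ f 1`. -/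
noncomputable def evalOne (M : ModuleCat.{u} A) : homObj k (unitObj k A) M ⟶ M :=
  ModuleCat.ofHom (evalOneLinear M)

/-- `1 ↦ id` as an `A`-linear map `k → [M, M]`. -/
noncomputable def idElementLinear (M : ModuleCat.{u} A) : unitObj k A →ₗ[A] homObj k M M where
  toFun c := toHom k (ofUnit c • LinearMap.id)
  map_add' c d := hom_ext fun m => by simp [add_smul]
  map_smul' a c := by
    have key : ∀ t : A ⊗[k] Aᵐᵒᵖ, ∀ m : M,
        bimoduleAction k M M t (ofUnit c • LinearMap.id) m =
          ofUnit c • LinearMap.mul' k A (gabiUnop k A t) • m := by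
      intro t m
      induction t using TensorProduct.induction_on with
      | zero => simp
      | add s t hs ht =>
        rw [map_add, LinearMap.add_apply, LinearMap.add_apply, hs, ht, map_add, map_add,
          add_smul, smul_add]
      | tmul p q => simp [bimoduleAction_tmul, mul_smul]
    refine hom_ext fun m => ?_
    rw [RingHom.id_apply, ofHom_smul, ofHom_toHom, ofHom_toHom, key, GabiAlgebra.antipode,
      algebraMap_smul, smul_smul, mul_comm]
    simp

variable (k) in
/-- `j_M : k ⟶ [M, M]`, `1 ↦ id`. -/
noncomputable def idElement (M : ModuleCat.{u} A) : unitObj k A ⟶ homObj k M M :=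
  ModuleCat.ofHom (idElementLinear M)

variable (k A) in
/-- The skew-closed structure on `A`-Mod for a gabi-algebra `A`, lifted from `k`-Mod: the internal
hom is `Hom_k(M, N)` with action `(a f)(m) = a₊ f(a₋ m)`, the unit is `k` with the action through
`ε`, and `i`, `j`, `Γ` are those of `k`-Mod. -/
noncomputable def skewClosedStructure : SkewClosedStructure (ModuleCat.{u} A) where
  unit := unitObj k A
  ihom := homFunctor k A
  i := { app := fun M => evalOne k M, naturality := fun _ _ _ => rfl }
  j M := idElement k M
  Γ M N P := comp k M N P
  j_dinatural {X Y} f := by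
    refine ModuleCat.hom_ext (LinearMap.ext fun c => hom_ext fun m => ?_)
    exact (f.hom.restrictScalars k).map_smul (ofUnit c) m
  Γ_natural_left _ _ _ _ _ := rfl
  Γ_natural_right _ _ _ _ _ := rfl
  Γ_dinatural _ _ _ := rfl
  j_i := by
    refine ModuleCat.hom_ext (LinearMap.ext fun c => unit_ext ?_)
    change ofUnit (ofUnit c • toUnit k A 1) = ofUnit c
    simp
  Γ_j_i X Y := by
    refine ModuleCat.hom_ext (LinearMap.ext fun f => hom_ext fun m => ?_)
    change ofHom k f ((1 : k) • m) = ofHom k f m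
    simp
  j_Γ X Y := by
    refine ModuleCat.hom_ext (LinearMap.ext fun c => hom_ext fun g => hom_ext fun m => ?_)
    exact (congrArg (fun F => F m) (ofHom_restricted_smul (M := X) (N := Y) (ofUnit c) g)).symm
  Γ_i X Y := rfl
  Γ_Γ _ _ _ _ := rfl

end

/-- The canonical map `β : A ⊗ A → A ⊗ A`, `a ⊗ b ↦ a₊ ⊗ a₋ b`. -/
noncomputable def canonicalMap (k A : Type u) [CommRing k] [Ring A] [Algebra k A]
    [GabiAlgebra k A] : A ⊗[k] A →ₗ[k] A ⊗[k] A :=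
  LinearMap.lTensor A (LinearMap.mul' k A) ∘ₗ (TensorProduct.assoc k A A A).toLinearMap ∘ₗ
    LinearMap.rTensor A (gabiUnop k A ∘ₗ (GabiAlgebra.δ (k := k) (A := A)).toLinearMap)

end GabiAlgebra

/-! If `C(X, [Y, -])` is represented by a universal `η : X ⟶ [Y, T]`, co-Yoneda collapses the coend
to `C(U, [T, Z])`, and `Γ̂` becomes `f ↦ [η, [Y, Z]] ∘ Γ ∘ f` (`bijective_gammaHat_iff`). Both
directions apply this to a suitable `T`.

If `Γ̂` is bijective, take `X = Y = U = A` and `T = Z = A ⊗ A`, with `A` acting on the left factor.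
An `A`-map `A → [A, V]` is a `k`-linear map `A → V`, hence an `A`-map `A ⊗ A → V`; the universal
element is `a ↦ (y ↦ β (a ⊗ y))`. So `Γ̂` becomes `r ↦ r ∘ β` on `End_k(A ⊗ A)`
(`bijective_comp_canonicalMap`), and its bijectivity forces `β` to be invertible.

If `β` is invertible, `Δ a = β⁻¹ (a ⊗ 1)` is an algebra map (`canonicalMap_mul`). It makes `X ⊗ Y`
an `A`-module for which `x ↦ (y ↦ x ⊗ y)` is universal (`tensorUnit_universal`), and the comparison
`[X ⊗ Y, Z] → [X, [Y, Z]]` is ordinary currying. -/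

namespace SkewClosedStructure

/-! ### Collapsing the coend by co-Yoneda. -/

variable {C : Type u₁} [Category.{v₁} C] (S : SkewClosedStructure C)

lemma ι_gammaHat (U X Y Z V : C) :
    Limits.coend.ι (S.normalityIntegrand U X Y Z) V ≫ S.gammaHat U X Y Z =
      TypeCat.ofHom fun p => ⟨S.gammaHatComponent p.down.1 p.down.2⟩ :=
  Limits.coend.ι_desc _ _ _

/-- A morphism `η : X ⟶ [Y, T]` is universal if every `g : X ⟶ [Y, V]` factors uniquely as
`[Y, h] ∘ η`. -/
def IsUniversal {X Y T : C} (η : X ⟶ (S.ihom.obj (op Y)).obj T) : Prop :=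
  ∀ (V : C) (g : X ⟶ (S.ihom.obj (op Y)).obj V),
    ∃! h : T ⟶ V, η ≫ (S.ihom.obj (op Y)).map h = g

variable {S} {X Y T : C} {η : X ⟶ (S.ihom.obj (op Y)).obj T}

namespace IsUniversal

/-- The factorization of `g` through a universal morphism. -/
noncomputable def desc (hη : S.IsUniversal η) {V : C} (g : X ⟶ (S.ihom.obj (op Y)).obj V) :
    T ⟶ V :=
  (hη V g).choose

lemma fac (hη : S.IsUniversal η) {V : C} (g : X ⟶ (S.ihom.obj (op Y)).obj V) :
    η ≫ (S.ihom.obj (op Y)).map (hη.desc g) = g :=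
  (hη V g).choose_spec.1

lemma desc_eq (hη : S.IsUniversal η) {V : C} {g : X ⟶ (S.ihom.obj (op Y)).obj V} {h : T ⟶ V}
    (w : η ≫ (S.ihom.obj (op Y)).map h = g) : hη.desc g = h :=
  ((hη V g).choose_spec.2 h w).symm

/-- The map out of the coend given by the co-Yoneda lemma for a universal morphism. -/
noncomputable def coendDesc (hη : S.IsUniversal η) (U Z : C) :
    Limits.coend (S.normalityIntegrand U X Y Z) ⟶
      ULift.{u₁} (U ⟶ (S.ihom.obj (op T)).obj Z) :=
  Limits.coend.desc
    (fun _ => TypeCat.ofHom fun p => ⟨p.down.1 ≫ (S.ihom.map (hη.desc p.down.2).op).app Z⟩)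
    (by
      intro V V' h
      ext p
      change (p.down.1 ≫ (S.ihom.map h.op).app Z) ≫ _ =
        p.down.1 ≫ (S.ihom.map (hη.desc (p.down.2 ≫ (S.ihom.obj (op Y)).map h)).op).app Z
      -- Uniqueness makes factorization natural in `V`, which is exactly dinaturality of the family.
      rw [hη.desc_eq (h := hη.desc p.down.2 ≫ h) (by
        rw [Functor.map_comp, ← Category.assoc, hη.fac])]
      simp
      rfl)

lemma ι_coendDesc (hη : S.IsUniversal η) (U Z V : C) :
    Limits.coend.ι (S.normalityIntegrand U X Y Z) V ≫ hη.coendDesc U Z =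
      TypeCat.ofHom fun p => ⟨p.down.1 ≫ (S.ihom.map (hη.desc p.down.2).op).app Z⟩ :=
  Limits.coend.ι_desc _ _ _

variable (η) in
/-- The map into the coend given by evaluation at a morphism `X ⟶ [Y, T]`. -/
noncomputable def toCoend (U Z : C) :
    ULift.{u₁} (U ⟶ (S.ihom.obj (op T)).obj Z) ⟶
      Limits.coend (S.normalityIntegrand U X Y Z) :=
  TypeCat.ofHom fun f => Limits.coend.ι (S.normalityIntegrand U X Y Z) T ⟨(f.down, η)⟩

lemma toCoend_coendDesc (hη : S.IsUniversal η) (U Z : C) :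
    toCoend η U Z ≫ hη.coendDesc U Z = 𝟙 _ := by
  refine ConcreteCategory.hom_ext _ _ fun f => ?_
  refine (congrArg (fun F => F ⟨(f.down, η)⟩) (hη.ι_coendDesc U Z T)).trans ?_
  change ULift.up (f.down ≫ (S.ihom.map (hη.desc η).op).app Z) = f
  rw [hη.desc_eq (h := 𝟙 T) (by simp)]
  simp

lemma coendDesc_toCoend (hη : S.IsUniversal η) (U Z : C) :
    hη.coendDesc U Z ≫ toCoend η U Z = 𝟙 _ := by
  refine Limits.coend.hom_ext fun V => ?_
  rw [coendDesc, Limits.coend.ι_desc_assoc, Category.comp_id]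
  ext ⟨f, g⟩
  -- Since `g = [Y, desc g] ∘ η`, the coend relation along `desc g` slides `(f, g)` to `([desc g, Z]
  -- ∘ f, η)`.
  have := congrArg (fun F => F ⟨(f, η)⟩)
    (Limits.coend.condition (S.normalityIntegrand U X Y Z) (hη.desc g))
  refine this.trans ?_
  change Limits.coend.ι (S.normalityIntegrand U X Y Z) V
    ⟨(f, η ≫ (S.ihom.obj (op Y)).map (hη.desc g))⟩ = _
  rw [hη.fac]
  rfl

lemma bijective_toCoend (hη : S.IsUniversal η) (U Z : C) :
    Function.Bijective (toCoend η U Z) :=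
  Function.bijective_iff_has_inverse.2 ⟨hη.coendDesc U Z,
    fun x => congrArg (fun F => F x) (hη.toCoend_coendDesc U Z),
    fun x => congrArg (fun F => F x) (hη.coendDesc_toCoend U Z)⟩

lemma gammaHat_toCoend (U Z : C) (f : ULift.{u₁} (U ⟶ (S.ihom.obj (op T)).obj Z)) :
    S.gammaHat U X Y Z (toCoend η U Z f) = ⟨S.gammaHatComponent f.down η⟩ :=
  congrArg (fun F => F ⟨(f.down, η)⟩) (S.ι_gammaHat U X Y Z T)

/-- When `C(X, [Y, -])` is represented by a universal morphism `η : X ⟶ [Y, T]`, the map `Γ̂`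
is bijective if and only if `f ↦ [η, [Y, Z]] ∘ Γ ∘ f` is. -/
lemma bijective_gammaHat_iff (hη : S.IsUniversal η) (U Z : C) :
    Function.Bijective (S.gammaHat U X Y Z) ↔
      Function.Bijective fun f : U ⟶ (S.ihom.obj (op T)).obj Z => S.gammaHatComponent f η := by
  have h : S.gammaHat U X Y Z ∘ toCoend η U Z =
      ULift.up ∘ (fun f : U ⟶ (S.ihom.obj (op T)).obj Z => S.gammaHatComponent f η) ∘
        ULift.down := funext fun f => gammaHat_toCoend U Z f
  rw [← Function.Bijective.of_comp_iff _ (hη.bijective_toCoend U Z), h,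
    Function.Bijective.of_comp_iff' (f := ULift.up) Equiv.ulift.symm.bijective,
    Function.Bijective.of_comp_iff _ (g := ULift.down) Equiv.ulift.bijective]

end IsUniversal

end SkewClosedStructure

namespace GabiAlgebra

-- Regular modules, and tensor products along an algebra map `A → A ⊗ A`.

attribute [local instance] restrictedModule

variable {k A : Type u} [CommRing k] [Ring A] [Algebra k A]

variable (A) in
/-- An `A`-module as an object of `A`-Mod; sealed, so that instance search does not see through it
to a `k`-module structure other than the one restricted from `A`. -/
def moduleObj (M : Type u) [AddCommGroup M] [Module A M] : ModuleCat.{u} A := ModuleCat.of A M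

variable (k A) in
/-- For a module over `k` and `A`, the `k`-module structure restricted from `A` agrees with the
given one. -/
def restrictedEquiv (M : Type u) [AddCommGroup M] [Module k M] [Module A M]
    [IsScalarTower k A M] : moduleObj A M ≃ₗ[k] M where
  toFun m := m
  invFun m := m
  map_add' _ _ := rfl
  map_smul' c m := algebraMap_smul A c (id m : M)
  left_inv _ := rfl
  right_inv _ := rfl

lemma restrictedEquiv_smul (M : Type u) [AddCommGroup M] [Module k M] [Module A M]
    [IsScalarTower k A M] (a : A) (m : moduleObj A M) :
    restrictedEquiv k A M (a • m) = a • restrictedEquiv k A M m := rfl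

section Regular

variable {R M : ModuleCat.{u} A} (ρ : R ≃ₗ[k] A) (hρ : ∀ a x, ρ (a • x) = a * ρ x)

/-- The morphism out of a regular module `R` sending the generator to `m`. -/
def regularDesc (m : M) : R ⟶ M :=
  ModuleCat.ofHom
    { toFun := fun x => ρ x • m
      map_add' := fun x y => by rw [map_add, add_smul]
      map_smul' := fun a x => by rw [hρ, mul_smul, RingHom.id_apply] }

lemma regularDesc_apply (m : M) (x : R) : (regularDesc ρ hρ m).hom x = ρ x • m := rfl

lemma regularDesc_one (m : M) : (regularDesc ρ hρ m).hom (ρ.symm 1) = m := by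
  rw [regularDesc_apply, LinearEquiv.apply_symm_apply, one_smul]

include hρ in
lemma regular_hom_ext {f g : R ⟶ M} (h : f.hom (ρ.symm 1) = g.hom (ρ.symm 1)) : f = g := by
  refine ModuleCat.hom_ext (LinearMap.ext fun x => ?_)
  have hx : x = ρ x • ρ.symm 1 := ρ.injective (by rw [hρ]; simp)
  rw [hx, map_smul, map_smul, h]

end Regular

section TensorObj

variable (k) in
/-- The componentwise action of `A ⊗ A` on `M ⊗ N`. -/
noncomputable def tensorAction (M N : ModuleCat.{u} A) :
    A ⊗[k] A →ₐ[k] Module.End k (M ⊗[k] N) :=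
  (Module.endTensorEndAlgHom (R := k) (S := k) (A := k)).comp
    (Algebra.TensorProduct.map (Algebra.lsmul k k M) (Algebra.lsmul k k N))

@[simp] lemma tensorAction_tmul (M N : ModuleCat.{u} A) (a b : A) (m : M) (n : N) :
    tensorAction k M N (a ⊗ₜ b) (m ⊗ₜ n) = (a • m) ⊗ₜ (b • n) := by
  simp only [tensorAction, AlgHom.comp_apply, Algebra.TensorProduct.map_tmul]
  rfl

/-- The `k`-module `M ⊗ N`, regarded as an `A`-module through an algebra map `A → A ⊗ A`. -/
def TensorModule (_Δ : A →ₐ[k] A ⊗[k] A) (M N : ModuleCat.{u} A) : Type u := M ⊗[k] N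

variable (Δ : A →ₐ[k] A ⊗[k] A) (M N : ModuleCat.{u} A)

noncomputable instance : AddCommGroup (TensorModule Δ M N) :=
  inferInstanceAs (AddCommGroup (M ⊗[k] N))

noncomputable instance : Module k (TensorModule Δ M N) :=
  inferInstanceAs (Module k (M ⊗[k] N))

noncomputable instance : Module A (TensorModule Δ M N) :=
  Module.compHom (M ⊗[k] N) ((tensorAction k M N).comp Δ).toRingHom

lemma tensorModule_smul_def (a : A) (t : TensorModule Δ M N) :
    a • t = (tensorAction k M N (Δ a) t : M ⊗[k] N) := rfl

instance : IsScalarTower k A (TensorModule Δ M N) :=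
  IsScalarTower.of_algebraMap_smul fun c t => by
    rw [tensorModule_smul_def, AlgHom.commutes, AlgHom.commutes]
    rfl

/-- The tensor product of two `A`-modules along an algebra map `A → A ⊗ A`. -/
noncomputable def tensorObj : ModuleCat.{u} A := moduleObj A (TensorModule Δ M N)

/-- The identification of the underlying `k`-module of the tensor product. -/
noncomputable def tensorObjEquiv : tensorObj Δ M N ≃ₗ[k] M ⊗[k] N :=
  restrictedEquiv k A (TensorModule Δ M N)

variable {M N}

@[elab_as_elim]
lemma tensorObj_induction {p : tensorObj Δ M N → Prop} (t : tensorObj Δ M N) (zero : p 0)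
    (tmul : ∀ m n, p ((tensorObjEquiv Δ M N).symm (m ⊗ₜ n)))
    (add : ∀ s t, p s → p t → p (s + t)) : p t :=
  TensorProduct.induction_on (motive := p) t zero tmul add

lemma smul_tensorObjEquiv_symm (a : A) (t : M ⊗[k] N) :
    a • (tensorObjEquiv Δ M N).symm t =
      (tensorObjEquiv Δ M N).symm (tensorAction k M N (Δ a) t) := rfl

end TensorObj

/-! ### The reduced form of `Γ̂` for `A`-modules, and `β` as a product in `A ⊗ A`. -/

variable [GabiAlgebra k A]

/-- The map `f ↦ [η, [Y, Z]] ∘ Γ ∘ f`, that is, `u ↦ x ↦ y ↦ f u (η x y)`. -/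
noncomputable def gammaComp {U X Y Z T : ModuleCat.{u} A} (f : U ⟶ homObj k T Z)
    (η : X ⟶ homObj k Y T) : U ⟶ homObj k X (homObj k Y Z) :=
  f ≫ comp k Y T Z ≫ homMap k η (𝟙 (homObj k Y Z))

lemma ofHom_gammaComp {U X Y Z T : ModuleCat.{u} A} (f : U ⟶ homObj k T Z)
    (η : X ⟶ homObj k Y T) (a : U) (x : X) (y : Y) :
    ofHom k (ofHom k ((gammaComp f η).hom a) x) y = ofHom k (f.hom a) (ofHom k (η.hom x) y) := rfl

lemma bijective_gammaHat_iff {X Y T : ModuleCat.{u} A} (η : X ⟶ homObj k Y T)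
    (hη : ∀ (V : ModuleCat.{u} A) (g : X ⟶ homObj k Y V), ∃! h : T ⟶ V,
      ∀ x y, h.hom (ofHom k (η.hom x) y) = ofHom k (g.hom x) y) (U Z : ModuleCat.{u} A) :
    Function.Bijective ((skewClosedStructure k A).gammaHat U X Y Z) ↔
      Function.Bijective fun f : U ⟶ homObj k T Z => gammaComp f η := by
  have : (skewClosedStructure k A).IsUniversal η := by
    intro V g
    obtain ⟨h, h₁, h₂⟩ := hη V g
    refine ⟨h, ModuleCat.hom_ext (LinearMap.ext fun x => hom_ext fun y => h₁ x y),
      fun h' w => h₂ h' fun x y => ?_⟩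
    subst w
    rfl
  exact this.bijective_gammaHat_iff U Z

/-- Writing `β` with the product of `A ⊗ A` lets later arguments replace `δ a` by an arbitrary
tensor and induct on it. -/
lemma canonicalMap_tmul (a b : A) :
    canonicalMap k A (a ⊗ₜ b) = gabiUnop k A (δ a) * (1 ⊗ₜ b) := by
  change LinearMap.lTensor A (LinearMap.mul' k A) (TensorProduct.assoc k A A A
    (gabiUnop k A (δ a) ⊗ₜ b)) = _
  induction gabiUnop k A (δ a) using TensorProduct.induction_on with
  | zero => simp
  | add s t hs ht => simp [hs, ht, add_mul, TensorProduct.add_tmul]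
  | tmul x y => simp

lemma canonicalMap_one_tmul (b : A) : canonicalMap k A (1 ⊗ₜ b) = 1 ⊗ₜ b := by
  rw [canonicalMap_tmul, map_one, Algebra.TensorProduct.one_def, gabiUnop_tmul]
  simp

/-! ### Associative normality implies that `β` is invertible. -/

section Free

variable {R F : ModuleCat.{u} A} (ρ : R ≃ₗ[k] A) (hρ : ∀ a x, ρ (a • x) = a * ρ x)
  (φ : F ≃ₗ[k] A ⊗[k] A) (hφ : ∀ a t, φ (a • t) = (a ⊗ₜ 1) * φ t)

/-- The unit `R ⟶ [R, R ⊗ R]`, `a ↦ (y ↦ β (a ⊗ y))`, for the regular module `R`. -/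
noncomputable def freeUnit : R ⟶ homObj k R F :=
  regularDesc ρ hρ
    (toHom k (φ.symm.toLinearMap ∘ₗ TensorProduct.mk k A A 1 ∘ₗ ρ.toLinearMap))

include hφ in
omit [GabiAlgebra k A] in
lemma bimoduleAction_free (t : A ⊗[k] Aᵐᵒᵖ) (y : R) (hρ : ∀ a x, ρ (a • x) = a * ρ x) :
    φ (bimoduleAction k R F t
      (φ.symm.toLinearMap ∘ₗ TensorProduct.mk k A A 1 ∘ₗ ρ.toLinearMap) y) =
    gabiUnop k A t * (1 ⊗ₜ ρ y) := by
  induction t using TensorProduct.induction_on with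
  | zero => simp
  | add s t hs ht => simp only [map_add, LinearMap.add_apply, hs, ht, add_mul]
  | tmul p q => simp [bimoduleAction_tmul, hφ, hρ]

include hφ in
lemma ofHom_freeUnit (x y : R) :
    φ (ofHom k ((freeUnit ρ hρ φ).hom x) y) = canonicalMap k A (ρ x ⊗ₜ ρ y) := by
  rw [freeUnit, regularDesc_apply, ofHom_smul, ofHom_toHom, bimoduleAction_free ρ φ hφ _ _ hρ,
    canonicalMap_tmul]

/-- The `k`-linear map `A ⊗ A → V`, `a ⊗ y ↦ a (f y)`. -/
noncomputable def freeDescLinear {V : ModuleCat.{u} A} (f : A →ₗ[k] V) : A ⊗[k] A →ₗ[k] V :=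
  TensorProduct.lift ((Algebra.lsmul k k V).toLinearMap.compl₂ f)

omit [GabiAlgebra k A] in
@[simp] lemma freeDescLinear_tmul {V : ModuleCat.{u} A} (f : A →ₗ[k] V) (a y : A) :
    freeDescLinear f (a ⊗ₜ y) = a • f y := rfl

omit [GabiAlgebra k A] in
lemma freeDescLinear_mul {V : ModuleCat.{u} A} (f : A →ₗ[k] V) (a : A) (t : A ⊗[k] A) :
    freeDescLinear f ((a ⊗ₜ 1) * t) = a • freeDescLinear f t := by
  induction t using TensorProduct.induction_on with
  | zero => simp
  | add s t hs ht => simp only [map_add, mul_add, hs, ht, smul_add]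
  | tmul p q => simp [mul_smul]

/-- The morphism `F ⟶ V`, `a ⊗ y ↦ a (f y)`. -/
noncomputable def freeDesc {V : ModuleCat.{u} A} (f : A →ₗ[k] V) : F ⟶ V :=
  ModuleCat.ofHom
    { toFun := fun t => freeDescLinear f (φ t)
      map_add' := fun s t => by simp
      map_smul' := fun a t => by rw [hφ, freeDescLinear_mul, RingHom.id_apply] }

omit [GabiAlgebra k A] in
lemma freeDesc_apply {V : ModuleCat.{u} A} (f : A →ₗ[k] V) (t : F) :
    (freeDesc φ hφ f).hom t = freeDescLinear f (φ t) := rfl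

-- A map out of `R` is determined by its value at the generator, a `k`-linear map `R → V`; this
-- extends uniquely to `F` because `F` is induced from the `k`-module `A` in the right factor.
include hφ in
lemma freeUnit_universal (V : ModuleCat.{u} A) (g : R ⟶ homObj k R V) :
    ∃! h : F ⟶ V, ∀ x y,
      h.hom (ofHom k ((freeUnit ρ hρ φ).hom x) y) = ofHom k (g.hom x) y := by
  refine ⟨freeDesc φ hφ (ofHom k (g.hom (ρ.symm 1)) ∘ₗ ρ.symm.toLinearMap), ?_, fun h hh => ?_⟩
  -- As an equality of morphisms out of `R`, this only needs checking at the generator, where `β (1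
  -- ⊗ y) = 1 ⊗ y`.
  · suffices freeUnit ρ hρ φ ≫ homMap k (𝟙 R)
        (freeDesc φ hφ (ofHom k (g.hom (ρ.symm 1)) ∘ₗ ρ.symm.toLinearMap)) = g by
      intro x y
      exact congrArg (fun F => ofHom k (F.hom x) y) this
    refine regular_hom_ext ρ hρ (hom_ext fun y => ?_)
    change (freeDesc φ hφ _).hom (ofHom k ((freeUnit ρ hρ φ).hom (ρ.symm 1)) y) = _
    rw [freeDesc_apply, ofHom_freeUnit ρ hρ φ hφ, LinearEquiv.apply_symm_apply,
      canonicalMap_one_tmul]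
    simp
  · refine ModuleCat.hom_ext (LinearMap.ext fun t => ?_)
    obtain ⟨t, rfl⟩ := φ.symm.surjective t
    rw [freeDesc_apply, LinearEquiv.apply_symm_apply]
    induction t using TensorProduct.induction_on with
    | zero => simp
    | add s t hs ht => simp only [map_add, hs, ht]
    | tmul a y =>
      -- `a ⊗ y = a • (1 ⊗ y)`, and `1 ⊗ y` is a value of the unit at the generator, so `hh`
      -- determines `h`.
      rw [freeDescLinear_tmul, LinearMap.comp_apply, LinearEquiv.coe_coe, ← hh, ← map_smul]
      refine congrArg h.hom (φ.injective ?_)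
      rw [hφ, ofHom_freeUnit ρ hρ φ hφ, LinearEquiv.apply_symm_apply, LinearEquiv.apply_symm_apply,
        LinearEquiv.apply_symm_apply, canonicalMap_one_tmul]
      simp

/-- The element `a ↦ y ↦ r (a ⊗ y)` of `[R, [R, F]]`. -/
noncomputable def curryElement (r : A ⊗[k] A →ₗ[k] A ⊗[k] A) : homObj k R (homObj k R F) :=
  toHom k
    { toFun := fun a => toHom k (φ.symm.toLinearMap ∘ₗ r ∘ₗ TensorProduct.mk k A A (ρ a) ∘ₗ
        ρ.toLinearMap)
      map_add' := fun a b => hom_ext fun y => by simp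
      map_smul' := fun c a => hom_ext fun y => by simp }

lemma ofHom_curryElement (r : A ⊗[k] A →ₗ[k] A ⊗[k] A) (a y : R) :
    ofHom k (ofHom k (curryElement ρ φ r) a) y = φ.symm (r (ρ a ⊗ₜ ρ y)) := rfl

lemma curryElement_injective :
    Function.Injective (curryElement ρ φ : _ → homObj k R (homObj k R F)) := by
  intro r r' h
  refine TensorProduct.ext' fun a y => φ.symm.injective ?_
  have := congrArg (fun F => ofHom k (ofHom k F (ρ.symm a)) (ρ.symm y)) h
  simpa [ofHom_curryElement] using this

/-- The element of `[F, F]` given by a `k`-linear endomorphism of `A ⊗ A`. -/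
noncomputable def endElement (r : A ⊗[k] A →ₗ[k] A ⊗[k] A) : homObj k F F :=
  toHom k (φ.symm.toLinearMap ∘ₗ r ∘ₗ φ.toLinearMap)

lemma endElement_injective :
    Function.Injective (endElement φ : _ → homObj k F F) := by
  intro r r' h
  refine LinearMap.ext fun t => φ.symm.injective ?_
  have := congrArg (fun F => ofHom k F (φ.symm t)) h
  simpa [endElement] using this

lemma endElement_surjective :
    Function.Surjective (endElement φ : _ → homObj k F F) := by
  intro f
  refine ⟨φ.toLinearMap ∘ₗ ofHom k f ∘ₗ φ.symm.toLinearMap, hom_ext fun m => ?_⟩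
  simp [endElement]

include hφ in
lemma gammaComp_freeUnit (r : A ⊗[k] A →ₗ[k] A ⊗[k] A) :
    gammaComp (regularDesc ρ hρ (endElement φ r)) (freeUnit ρ hρ φ) =
      regularDesc ρ hρ (curryElement ρ φ (r ∘ₗ canonicalMap k A)) := by
  refine regular_hom_ext ρ hρ (hom_ext fun a => hom_ext fun y => ?_)
  rw [ofHom_gammaComp, regularDesc_one, regularDesc_one, ofHom_curryElement, endElement,
    ofHom_toHom]
  simp [ofHom_freeUnit ρ hρ φ hφ]

-- With `U = R`, morphisms out of `U` are elements. Those of `[F, F]` and, after uncurrying, those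
-- of `[R, [R, F]]` are both the `k`-endomorphisms of `A ⊗ A`.
include hρ hφ in
lemma bijective_comp_canonicalMap (h : (skewClosedStructure k A).AssociativeNormal) :
    Function.Bijective fun r : A ⊗[k] A →ₗ[k] A ⊗[k] A => r ∘ₗ canonicalMap k A := by
  have key := (bijective_gammaHat_iff (freeUnit ρ hρ φ) (freeUnit_universal ρ hρ φ hφ) R F).1
    (h _ _ _ _)
  refine ⟨fun r r' hr => endElement_injective φ ?_, fun s => ?_⟩
  · have := @key.1 (regularDesc ρ hρ (endElement φ r)) (regularDesc ρ hρ (endElement φ r')) (by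
      dsimp only at hr ⊢
      rw [gammaComp_freeUnit ρ hρ φ hφ, gammaComp_freeUnit ρ hρ φ hφ, hr])
    rw [← regularDesc_one ρ hρ (endElement φ r), this, regularDesc_one]
  · obtain ⟨f, hf⟩ := key.2 (regularDesc ρ hρ (curryElement ρ φ s))
    obtain ⟨r, hr⟩ := endElement_surjective φ (f.hom (ρ.symm 1))
    obtain rfl : f = regularDesc ρ hρ (endElement φ r) :=
      regular_hom_ext ρ hρ (by rw [regularDesc_one, hr])
    refine ⟨r, curryElement_injective ρ φ ?_⟩
    dsimp only at hf ⊢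
    rw [gammaComp_freeUnit ρ hρ φ hφ] at hf
    rw [← regularDesc_one ρ hρ (curryElement ρ φ (r ∘ₗ _)), hf, regularDesc_one]

end Free

lemma bijective_canonicalMap (h : (skewClosedStructure k A).AssociativeNormal) :
    Function.Bijective (canonicalMap k A) := by
  have key := bijective_comp_canonicalMap (restrictedEquiv k A A) (restrictedEquiv_smul A)
    (restrictedEquiv k A (A ⊗[k] A)) (fun a t => by
      rw [restrictedEquiv_smul]
      induction restrictedEquiv k A (A ⊗[k] A) t using TensorProduct.induction_on with
      | zero => simp
      | add s t hs ht => simp only [smul_add, mul_add, hs, ht]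
      | tmul p q => simp [TensorProduct.smul_tmul']) h
  obtain ⟨r, hr⟩ := key.2 LinearMap.id
  -- The left inverse `r` is also a right inverse: `β ∘ r` and `id` agree after precomposing with
  -- `β`, which is injective on endomorphisms.
  have hr' : canonicalMap k A ∘ₗ r = LinearMap.id := key.1 (by
    dsimp only at hr ⊢
    rw [LinearMap.comp_assoc, hr, LinearMap.comp_id, LinearMap.id_comp])
  exact Function.bijective_iff_has_inverse.2
    ⟨r, fun t => LinearMap.congr_fun hr t, fun t => LinearMap.congr_fun hr' t⟩

/-! ### The algebra map `Δ a = β⁻¹ (a ⊗ 1)`. -/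

lemma canonicalMap_mul_one_tmul (t : A ⊗[k] A) (b : A) :
    canonicalMap k A (t * (1 ⊗ₜ b)) = canonicalMap k A t * (1 ⊗ₜ b) := by
  induction t using TensorProduct.induction_on with
  | zero => simp
  | add s t hs ht => simp only [add_mul, map_add, hs, ht]
  | tmul c d => simp [canonicalMap_tmul, mul_assoc]

variable (k A) in
/-- The `k`-linear map sending `x ⊗ y` to `s ↦ (1 ⊗ y) s (x ⊗ 1)`. -/
noncomputable def sandwich : A ⊗[k] Aᵐᵒᵖ →ₗ[k] Module.End k (A ⊗[k] A) :=
  TensorProduct.lift (LinearMap.mk₂ k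
    (fun x y => LinearMap.mulLeftRight k (((1 : A) ⊗ₜ[k] y.unop), (x ⊗ₜ[k] (1 : A))))
    (fun x x' y => by ext; simp [TensorProduct.add_tmul, mul_add])
    (fun c x y => by ext; simp [TensorProduct.smul_tmul'])
    (fun x y y' => by ext; simp [TensorProduct.tmul_add, add_mul])
    (fun c x y => by ext; simp))

omit [GabiAlgebra k A] in
@[simp] lemma sandwich_tmul (x : A) (y : Aᵐᵒᵖ) (s : A ⊗[k] A) :
    sandwich k A (x ⊗ₜ y) s = (1 ⊗ₜ y.unop) * s * (x ⊗ₜ 1) := by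
  simp [sandwich]

-- The second factor multiplies in the opposite order, so right multiplication by `w` in `A ⊗ Aᵒᵖ`
-- acts from the right on the first factor and from the left on the second.
omit [GabiAlgebra k A] in
lemma gabiUnop_mul (v w : A ⊗[k] Aᵐᵒᵖ) (d : A) :
    gabiUnop k A (v * w) * (1 ⊗ₜ d) = sandwich k A w (gabiUnop k A v * (1 ⊗ₜ d)) := by
  induction v using TensorProduct.induction_on with
  | zero => simp
  | add s t hs ht => simp only [add_mul, map_add, hs, ht]
  | tmul p q =>
    induction w using TensorProduct.induction_on with
    | zero => simp
    | add s t hs ht => simp only [mul_add, add_mul, map_add, hs, ht, LinearMap.add_apply]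
    | tmul x y => simp [mul_assoc]

omit [GabiAlgebra k A] in
lemma sandwich_tmul_one (w : A ⊗[k] Aᵐᵒᵖ) (a : A) :
    sandwich k A w (a ⊗ₜ 1) = (a ⊗ₜ 1) * gabiUnop k A w := by
  induction w using TensorProduct.induction_on with
  | zero => simp
  | add s t hs ht => simp only [mul_add, map_add, hs, ht, LinearMap.add_apply]
  | tmul x y => simp

lemma canonicalMap_mul_tmul (t : A ⊗[k] A) (e f : A) :
    canonicalMap k A (t * (e ⊗ₜ f)) = sandwich k A (δ e) (canonicalMap k A t) * (1 ⊗ₜ f) := by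
  induction t using TensorProduct.induction_on with
  | zero => simp
  | add s t hs ht => simp only [add_mul, map_add, hs, ht]
  | tmul c d =>
    rw [Algebra.TensorProduct.tmul_mul_tmul, canonicalMap_tmul, canonicalMap_tmul, map_mul,
      ← gabiUnop_mul, mul_assoc, Algebra.TensorProduct.tmul_mul_tmul, one_mul]

/-- On `a ⊗ 1` the two-sided action of `δ e` is just right multiplication by `e₊ ⊗ e₋`, as the
second factor is `1`. Applied to `t = β⁻¹ (a ⊗ 1)` and `s = β⁻¹ (b ⊗ 1)`, this gives
multiplicativity of `Δ`. -/
lemma canonicalMap_mul {t : A ⊗[k] A} {a : A} (ht : canonicalMap k A t = a ⊗ₜ 1)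
    (s : A ⊗[k] A) : canonicalMap k A (t * s) = (a ⊗ₜ 1) * canonicalMap k A s := by
  induction s using TensorProduct.induction_on with
  | zero => simp
  | add s t hs ht => simp only [mul_add, map_add, hs, ht]
  | tmul e f =>
    rw [canonicalMap_mul_tmul, ht, sandwich_tmul_one, canonicalMap_tmul, mul_assoc]

lemma canonicalMap_one : canonicalMap k A 1 = 1 := by
  rw [Algebra.TensorProduct.one_def, canonicalMap_tmul, map_one, ← Algebra.TensorProduct.one_def,
    mul_one]
  rfl

/-- When `β` is invertible, `a ↦ β⁻¹ (a ⊗ 1)` is an algebra map. -/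
noncomputable def comulOfBijective (hβ : Function.Bijective (canonicalMap k A)) :
    A →ₐ[k] A ⊗[k] A :=
  AlgHom.ofLinearMap
    ((LinearEquiv.ofBijective _ hβ).symm.toLinearMap ∘ₗ (TensorProduct.mk k A A).flip 1)
    ((LinearEquiv.symm_apply_eq _).2 canonicalMap_one.symm)
    (fun a b => (LinearEquiv.symm_apply_eq _).2 <| by
      have h (c : A) : canonicalMap k A ((LinearEquiv.ofBijective _ hβ).symm (c ⊗ₜ 1)) = c ⊗ₜ 1 :=
        (LinearEquiv.ofBijective _ hβ).apply_symm_apply _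
      refine Eq.trans ?_ (canonicalMap_mul (h a) _).symm
      change _ = _ * canonicalMap k A ((LinearEquiv.ofBijective _ hβ).symm (b ⊗ₜ 1))
      simp [h])

lemma canonicalMap_comulOfBijective (hβ : Function.Bijective (canonicalMap k A)) (a : A) :
    canonicalMap k A (comulOfBijective hβ a) = a ⊗ₜ 1 :=
  (LinearEquiv.ofBijective _ hβ).apply_symm_apply _

/-! ### The tensor-hom adjunction when `β` is invertible. -/

section Unit

variable (hβ : Function.Bijective (canonicalMap k A)) (X Y : ModuleCat.{u} A)

/-- `p ⊗ q` sends `y ↦ x ⊗ y` to `y ↦ Δ(p) (x ⊗ q y)`, and `Δ(p) (1 ⊗ q) = β⁻¹ (p ⊗ q)`. For `t = δ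
a` one may take `s = a ⊗ 1`, whence `A`-linearity of the unit. -/
lemma bimoduleAction_mk (t : A ⊗[k] Aᵐᵒᵖ) (s : A ⊗[k] A)
    (hs : canonicalMap k A s = gabiUnop k A t) (x : X) (y : Y) :
    bimoduleAction k Y (tensorObj (comulOfBijective hβ) X Y) t
      ((tensorObjEquiv (comulOfBijective hβ) X Y).symm.toLinearMap ∘ₗ TensorProduct.mk k X Y x) y =
    (tensorObjEquiv (comulOfBijective hβ) X Y).symm (tensorAction k X Y s (x ⊗ₜ y)) := by
  -- With `s` written as `β⁻¹` of `t`, both sides are additive in `t` and induction applies.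
  obtain rfl : s = (LinearEquiv.ofBijective _ hβ).symm (gabiUnop k A t) :=
    ((LinearEquiv.symm_apply_eq _).2 hs.symm).symm
  clear hs
  induction t using TensorProduct.induction_on with
  | zero => simp
  | add s t hs ht => simp only [map_add, LinearMap.add_apply, hs, ht]
  | tmul p q =>
    have : (LinearEquiv.ofBijective _ hβ).symm (gabiUnop k A (p ⊗ₜ q)) =
        comulOfBijective hβ p * (1 ⊗ₜ q.unop) := by
      refine (LinearEquiv.symm_apply_eq _).2 (Eq.trans ?_ (canonicalMap_mul_one_tmul _ _).symm)
      simp [canonicalMap_comulOfBijective]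
    rw [bimoduleAction_tmul, this, map_mul, Module.End.mul_apply, tensorAction_tmul, one_smul]
    rfl

/-- The `A`-linear map `X → [Y, X ⊗ Y]`, `x ↦ (y ↦ x ⊗ y)`. -/
noncomputable def tensorUnitLinear : X →ₗ[A] homObj k Y (tensorObj (comulOfBijective hβ) X Y) where
  toFun x := toHom k ((tensorObjEquiv (comulOfBijective hβ) X Y).symm.toLinearMap ∘ₗ
    TensorProduct.mk k X Y x)
  map_add' x x' := hom_ext fun y => by simp
  map_smul' a x := hom_ext fun y => by
    rw [RingHom.id_apply, ofHom_smul, ofHom_toHom, ofHom_toHom,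
      bimoduleAction_mk hβ X Y _ (a ⊗ₜ 1)]
    · simp
    · rw [canonicalMap_tmul, ← Algebra.TensorProduct.one_def, mul_one]

/-- The unit `X ⟶ [Y, X ⊗ Y]`, `x ↦ (y ↦ x ⊗ y)`. -/
noncomputable def tensorUnit : X ⟶ homObj k Y (tensorObj (comulOfBijective hβ) X Y) :=
  ModuleCat.ofHom (tensorUnitLinear hβ X Y)

lemma ofHom_tensorUnit (x : X) (y : Y) :
    ofHom k ((tensorUnit hβ X Y).hom x) y =
      (tensorObjEquiv (comulOfBijective hβ) X Y).symm (x ⊗ₜ y) := rfl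

variable {X Y}

/-- The `k`-linear map `X ⊗ Y → V` corresponding to `X ⟶ [Y, V]`. -/
noncomputable def uncurryLinear {V : ModuleCat.{u} A} (g : X →ₗ[k] homObj k Y V) :
    X ⊗[k] Y →ₗ[k] V :=
  TensorProduct.lift
    { toFun := fun x => ofHom k (g x)
      map_add' := fun x x' => by simp
      map_smul' := fun c x => by simp }

@[simp] lemma uncurryLinear_tmul {V : ModuleCat.{u} A} (g : X →ₗ[k] homObj k Y V) (x : X) (y : Y) :
    uncurryLinear g (x ⊗ₜ y) = ofHom k (g x) y := rfl

/-- The `k`-linear map `p ⊗ q ↦ p f(q y)`. -/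
noncomputable def evalPair {V : ModuleCat.{u} A} (f : Y →ₗ[k] V) (y : Y) : A ⊗[k] A →ₗ[k] V :=
  TensorProduct.lift ((Algebra.lsmul k k V).toLinearMap.compl₂
    (f ∘ₗ (Algebra.lsmul k k Y).toLinearMap.flip y))

omit [GabiAlgebra k A] in
@[simp] lemma evalPair_tmul {V : ModuleCat.{u} A} (f : Y →ₗ[k] V) (y : Y) (p q : A) :
    evalPair f y (p ⊗ₜ q) = p • f (q • y) := rfl

omit [GabiAlgebra k A] in
lemma bimoduleAction_eq_evalPair {V : ModuleCat.{u} A} (f : Y →ₗ[k] V) (y : Y) (b : A)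
    (t : A ⊗[k] Aᵐᵒᵖ) :
    bimoduleAction k Y V t f (b • y) = evalPair f y (gabiUnop k A t * (1 ⊗ₜ b)) := by
  induction t using TensorProduct.induction_on with
  | zero => simp
  | add s t hs ht => simp [hs, ht, add_mul]
  | tmul p q => simp [bimoduleAction_tmul, mul_smul]

/-- By linearity of `g`, `c x ⊗ d y` goes to `c₊ g(x)(c₋ d y)`, where `β (c ⊗ d)` appears. For `t =
Δ a` this is `a g(x)(y)`, so the transpose of `g` is `A`-linear. -/
lemma uncurryLinear_tensorAction {V : ModuleCat.{u} A} (g : X ⟶ homObj k Y V) (x : X) (y : Y)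
    (t : A ⊗[k] A) :
    uncurryLinear (g.hom.restrictScalars k) (tensorAction k X Y t (x ⊗ₜ y)) =
      evalPair (ofHom k (g.hom x)) y (canonicalMap k A t) := by
  induction t using TensorProduct.induction_on with
  | zero => simp
  | add s t hs ht => simp [hs, ht]
  | tmul c d =>
    rw [tensorAction_tmul, uncurryLinear_tmul, LinearMap.coe_restrictScalars, map_smul g.hom,
      ofHom_smul, canonicalMap_tmul, bimoduleAction_eq_evalPair]

/-- The `A`-linear map `X ⊗ Y → V` corresponding to `X ⟶ [Y, V]`. -/
noncomputable def tensorDescLinear {V : ModuleCat.{u} A} (g : X ⟶ homObj k Y V) :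
    tensorObj (comulOfBijective hβ) X Y →ₗ[A] V where
  toFun t := uncurryLinear (g.hom.restrictScalars k) (tensorObjEquiv (comulOfBijective hβ) X Y t)
  map_add' s t := by simp
  map_smul' a t := by
    induction t using tensorObj_induction with
    | zero => simp
    | add s t hs ht => simp_all
    | tmul x y =>
      rw [smul_tensorObjEquiv_symm, LinearEquiv.apply_symm_apply, uncurryLinear_tensorAction,
        canonicalMap_comulOfBijective]
      simp

/-- The morphism `X ⊗ Y ⟶ V` corresponding to `X ⟶ [Y, V]`. -/
noncomputable def tensorDesc {V : ModuleCat.{u} A} (g : X ⟶ homObj k Y V) :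
    tensorObj (comulOfBijective hβ) X Y ⟶ V :=
  ModuleCat.ofHom (tensorDescLinear hβ g)

lemma tensorDesc_tmul {V : ModuleCat.{u} A} (g : X ⟶ homObj k Y V) (x : X) (y : Y) :
    (tensorDesc hβ g).hom ((tensorObjEquiv (comulOfBijective hβ) X Y).symm (x ⊗ₜ y)) =
      ofHom k (g.hom x) y := rfl

lemma tensorUnit_universal (V : ModuleCat.{u} A) (g : X ⟶ homObj k Y V) :
    ∃! h : tensorObj (comulOfBijective hβ) X Y ⟶ V,
      ∀ x y, h.hom (ofHom k ((tensorUnit hβ X Y).hom x) y) = ofHom k (g.hom x) y := by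
  refine ⟨tensorDesc hβ g, fun _ _ => rfl, fun h hh => ?_⟩
  refine ModuleCat.hom_ext (LinearMap.ext fun t => ?_)
  induction t using tensorObj_induction with
  | zero => simp
  | add s t hs ht => simp only [map_add, hs, ht]
  | tmul x y => rw [tensorDesc_tmul, ← hh, ofHom_tensorUnit]

-- On elements this map is currying of `k`-linear maps out of `X ⊗ Y`.
variable (X Y) in
lemma bijective_tensorUnit_comp (Z : ModuleCat.{u} A) :
    Function.Bijective (comp k Y (tensorObj (comulOfBijective hβ) X Y) Z ≫
      homMap k (tensorUnit hβ X Y) (𝟙 (homObj k Y Z))).hom := by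
  refine ⟨fun f f' h => hom_ext fun t => ?_, fun f => ?_⟩
  · induction t using tensorObj_induction with
    | zero => simp
    | add s t hs ht => simp only [map_add, hs, ht]
    | tmul x y => exact congrArg (fun F => ofHom k (ofHom k F x) y) h
  · exact ⟨toHom k (uncurryLinear (ofHom k f) ∘ₗ
      (tensorObjEquiv (comulOfBijective hβ) X Y).toLinearMap), rfl⟩

end Unit

lemma associativeNormal_of_bijective (hβ : Function.Bijective (canonicalMap k A)) :
    (skewClosedStructure k A).AssociativeNormal := by
  intro U X Y Z
  rw [bijective_gammaHat_iff (tensorUnit hβ X Y) (tensorUnit_universal hβ)]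
  -- The reduced `Γ̂` is postcomposition with this morphism, so an isomorphism gives bijectivity for
  -- every `U`.
  have : IsIso (comp k Y (tensorObj (comulOfBijective hβ) X Y) Z ≫
      homMap k (tensorUnit hβ X Y) (𝟙 (homObj k Y Z))) :=
    (ConcreteCategory.isIso_iff_bijective _).2 (bijective_tensorUnit_comp hβ X Y Z)
  exact ((asIso (comp k Y (tensorObj (comulOfBijective hβ) X Y) Z ≫
      homMap k (tensorUnit hβ X Y) (𝟙 (homObj k Y Z)))).homToEquiv (Z := U)).bijective

end GabiAlgebra

theorem proposition4p11 (k A : Type u) [CommRing k] [Ring A] [Algebra k A] [GabiAlgebra k A] :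
    (GabiAlgebra.skewClosedStructure k A).AssociativeNormal ↔
      Function.Bijective (GabiAlgebra.canonicalMap k A) :=
  ⟨GabiAlgebra.bijective_canonicalMap, GabiAlgebra.associativeNormal_of_bijective⟩
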